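/- **Setting.** A graph on $[n]$ is a set $E\subseteq[n]^2$ of directed edges without self-loops; it carries node features $\mathbf X\in\mathbb R^{n\times d_v}$ and edge features $\mathbf E_{ij}\in\mathbb R^{d_e}$, $(i,j)\in E$. *Message-passing neural networks.* A message passing step is given by a message function $M$ and an update function $U$ and maps node features $\mathbf X$ to $\mathbf H$, where $$\mathbf M_j=\sum_{i:\,(i,j)\in E}M(\mathbf X_j,\mathbf X_i,\mathbf E_{ij}),\qquad \mathbf H_j=U(\mathbf X_j,\mathbf M_j).$$ A message-passing neural network (MPNN) with $T\ge 0$ steps is a composition of $T$ such steps, each with its own $M$, $U$ and feature dimensions, and all using the same edge features. It is continuous if all its $M$ and $U$ are. *Second-order sparse Transformers with kernel attention.* Fix a head size $d_H\ge 1$ and a kernel feature map $\phi:\mathbb R^{d_H}\to\mathbb R_{\ge 0}^{d_K}$. For multi-indices $\mathbf i,\mathbf j\in[n]^2$, let $\mu$ range over the partitions of the four index positions of $(\mathbf i,\mathbf j)$, with $(\mathbf i,\mathbf j)\in\mu$ iff exactly the positions in the same block carry equal nodes; let $\lambda$ range likewise over the partitions of the two positions of $\mathbf j$. Let $E'=E\cup\{(i,i):i\in[n]\}$.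 For a tensor $\mathbf A\in\mathbb R^{n^2\times d}$, a lightweight sparse linear layer is $$\bar L(\mathbf A)_{\mathbf j}=\sum_{\mu\in\mathcal M}\ \sum_{\mathbf i\in E',\,(\mathbf i,\mathbf j)\in\mu}\mathbf A_{\mathbf i}w_\mu+\sum_{\lambda\ni\mathbf j}b_\lambda\quad(\mathbf j\in E'),\qquad \bar L(\mathbf A)_{\mathbf j}=0\quad(\mathbf j\notin E'),$$ where $\mathcal M$ consists of the $\mu$ in which every position of $\mathbf i$ shares a block with a position of $\mathbf j$. A Transformer layer is $\mathrm{Enc}(\mathbf A)=\mathrm{Attn}(\mathbf A)+\bar L^2(\mathrm{ReLU}(\bar L^1(\mathrm{Attn}(\mathbf A))))$ with unnormalized kernel attention $$\mathrm{Attn}(\mathbf A)_{\mathbf j}=\sum_{h=1}^H\sum_\mu\ \sum_{\mathbf i\in E',\,(\mathbf i,\mathbf j)\in\mu}\phi(\mathbf Q^{h,\mu}_{\mathbf j})^\top\phi(\mathbf K^{h,\mu}_{\mathbf i})\,\mathbf A_{\mathbf i}w^V_{h,\mu}w^O_{h,\mu}\quad(\mathbf j\in E'),$$ and $\mathrm{Attn}(\mathbf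 A)_{\mathbf j}=0$ for $\mathbf j\notin E'$. Here $\mathbf Q^{h,\mu}$ and $\mathbf K^{h,\mu}$ are lightweight sparse linear layers of $\mathbf A$ with $d_H$ output channels, $w^V_{h,\mu}\in\mathbb R^{d\times d_H}$ and $w^O_{h,\mu}\in\mathbb R^{d_H\times d'}$; the number of heads, the hidden dimension and the channel dimensions $d,d'$ of each layer are arbitrary. The Transformer is applied to $\mathbf A_{ij}=(\mathbf X_i,\mathbf X_j,\mathbf E_{ij})$ (with $\mathbf E_{ij}:=0$ if $(i,j)\notin E$); it composes such layers, and its output at node $j$ is a linear map applied to the $(j,j)$ entry of the last layer. Its parameters do not depend on $n$ or $E$. **Statement.** Suppose $d_H\ge1$ and $\phi$ is not identically zero. Second-order sparse Transformers with kernel attention are strictly more expressive than message-passing neural networks, in the following sense. 1. For every continuous MPNN $P$ with $T$ steps, all $n_0\in\mathbb N$, $R\in\mathbb R$ and $\varepsilon>0$, there is a second-order sparse Transformer $S$ with $2T$ layers such that for every graph on $n\le n_0$ nodes, all node and edge features with entries in $[-R,R]$, and every node $j$, $\ \|S(E,\mathbf X,\mathbf E)_j-P(E,\mathbf X,\mathbf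 E)_j\|_\infty<\varepsilon$. 2. The converse fails: for all $d_v,d\ge1$ and $d_e\ge 0$ there are a second-order sparse Transformer $S$ with a single layer and output dimension $d$, and an $\varepsilon>0$, such that for every graph whose underlying undirected graph has more than one connected component, and every MPNN $P$ with output dimension $d$, with any number of steps and arbitrary (not necessarily continuous) message and update functions, there are node and edge features with entries in $[-1,1]$ and a node $j$ with $\|S(E,\mathbf X,\mathbf E)_j-P(E,\mathbf X,\mathbf E)_j\|_\infty\ge\varepsilon$. -/

import Mathlib

/-! ### Tensors, multi-indices and equality patterns -/

/-- Order-`k` multi-indices over the node set `[n]`. -/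
abbrev MultiIndex (k n : ℕ) : Type := Fin k → Fin n

/-- Order-`k` tensors over `[n]` with `d` feature channels. -/
abbrev Tensor (k n d : ℕ) : Type := MultiIndex k n → Fin d → ℝ

/-- Equivalence classes of order-`k` multi-indices under node permutations are encoded, independently
of `n`, by partitions of the set of the `k` index positions (the equality patterns). -/
abbrev IdxClass (k : ℕ) : Type := Setoid (Fin k)

/-- Equivalence classes `μ` of order-`(k+l)` multi-indices `(𝐢, 𝐣)`: partitions of the `k` input
positions together with the `l` output positions. -/
abbrev PairClass (k l : ℕ) : Type := Setoid (Fin k ⊕ Fin l)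

theorem setoid_finite (ι : Type) [Finite ι] : Finite (Setoid ι) :=
  Finite.of_injective (fun s : Setoid ι => s.r) fun _ _ h =>
    Setoid.ext fun x y => iff_of_eq (congrFun (congrFun h x) y)

noncomputable instance setoidFintype (ι : Type) [Finite ι] : Fintype (Setoid ι) :=
  haveI := setoid_finite ι
  Fintype.ofFinite _

/-- `(𝐢, 𝐣) ∈ μ`: two positions of `(𝐢, 𝐣)` carry the same node iff they lie in the same block. -/
def PairClass.Mem {k l n : ℕ} (μ : PairClass k l) (i : MultiIndex k n) (j : MultiIndex l n) : Prop :=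
  Setoid.ker (Sum.elim i j) = μ

/-- `𝐣 ∈ lam` for a class of order-`l` multi-indices. -/
def IdxClass.Mem {l n : ℕ} (lam : IdxClass l) (j : MultiIndex l n) : Prop :=
  Setoid.ker j = lam

open Classical in
/-- Basis tensor `𝐁^μ` of the weights of an equivariant linear layer. -/
noncomputable def basisB {k l n : ℕ} (μ : PairClass k l) (i : MultiIndex k n) (j : MultiIndex l n) :
    ℝ := if μ.Mem i j then 1 else 0

open Classical in
/-- Basis tensor `𝐂^lam` of the biases of an equivariant linear layer. -/
noncomputable def basisC {l n : ℕ} (lam : IdxClass l) (j : MultiIndex l n) : ℝ :=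
  if lam.Mem j then 1 else 0

/-- The classes used by lightweight linear layers: every input position is identified with some
output position, so that no summation over the input takes place. -/
def PairClass.Lightweight {k l : ℕ} (μ : PairClass k l) : Prop :=
  ∀ a : Fin k, ∃ b : Fin l, μ (Sum.inl a) (Sum.inr b)

/-! ### Sparse lightweight equivariant linear layers -/

/-- Parameters of a lightweight equivariant linear layer `ℝ^{n^k × d} → ℝ^{n^l × d'}`
(they do not depend on `n`; only the weights of the lightweight classes are used). -/
structure LightLinear (k l d d' : ℕ) where
  weight : PairClass k l → Matrix (Fin d) (Fin d') ℝ
  bias : IdxClass l → Fin d' → ℝ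

open Classical in
/-- Sparse lightweight linear layer with input hyperedges `E` and output hyperedges `E'`. -/
noncomputable def LightLinear.eval {k l d d' n : ℕ} (L : LightLinear k l d d')
    (E : Finset (MultiIndex k n)) (E' : Finset (MultiIndex l n)) (A : Tensor k n d) :
    Tensor l n d' := fun j =>
  if j ∈ E' then
    (∑ μ : PairClass k l with μ.Lightweight, ∑ i ∈ E,
        basisB μ i j • Matrix.vecMul (A i) (L.weight μ))
      + ∑ lam : IdxClass l, basisC lam j • L.bias lam
  else 0

/-! ### Sparse Transformer layers with kernel attention -/

/-- Parameters of a Transformer layer `Enc_{k → l}` with head size `dH`, mapping `d` channels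
to `d'` channels. -/
structure EncLayer (dH k l d d' : ℕ) where
  /-- number of heads -/
  heads : ℕ
  query : Fin heads → PairClass k l → LightLinear k l d dH
  key : Fin heads → PairClass k l → LightLinear k k d dH
  wV : Fin heads → PairClass k l → Matrix (Fin d) (Fin dH) ℝ
  wO : Fin heads → PairClass k l → Matrix (Fin dH) (Fin d') ℝ
  /-- hidden dimension of the MLP -/
  dF : ℕ
  mlp₁ : LightLinear l l d' dF
  mlp₂ : LightLinear l l dF d'

section
variable {dH dK k l d d' n : ℕ}

open Classical in
/-- Kernel attention coefficient `α^{h,μ}_{𝐢,𝐣} = φ(𝐐_𝐣)ᵀ φ(𝐊_𝐢)` if `(𝐢, 𝐣) ∈ μ`, `𝐢 ∈ E`, `𝐣 ∈ E'`,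
and `0` otherwise (no normalization). -/
noncomputable def EncLayer.coeff (φ : (Fin dH → ℝ) → Fin dK → ℝ) (P : EncLayer dH k l d d')
    (E : Finset (MultiIndex k n)) (E' : Finset (MultiIndex l n)) (A : Tensor k n d)
    (h : Fin P.heads) (μ : PairClass k l) (i : MultiIndex k n) (j : MultiIndex l n) : ℝ :=
  if μ.Mem i j ∧ i ∈ E ∧ j ∈ E' then
    φ ((P.query h μ).eval E E' A j) ⬝ᵥ φ ((P.key h μ).eval E E A i)
  else 0

/-- Sparse self-attention `Attn_{k → l}(A, E)`. -/
noncomputable def EncLayer.attn (φ : (Fin dH → ℝ) → Fin dK → ℝ) (P : EncLayer dH k l d d')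
    (E : Finset (MultiIndex k n)) (E' : Finset (MultiIndex l n)) (A : Tensor k n d) :
    Tensor l n d' := fun j =>
  if j ∈ E' then
    ∑ h : Fin P.heads, ∑ μ : PairClass k l, ∑ i ∈ E,
      P.coeff φ E E' A h μ i j • Matrix.vecMul (Matrix.vecMul (A i) (P.wV h μ)) (P.wO h μ)
  else 0

/-- The feedforward part: two sparse lightweight linear layers with a ReLU in between. -/
noncomputable def EncLayer.mlp (P : EncLayer dH k l d d')
    (E' : Finset (MultiIndex l n)) (A : Tensor l n d') : Tensor l n d' :=
  P.mlp₂.eval E' E' fun j c => max (P.mlp₁.eval E' E' A j c) 0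

/-- The layer `Enc_{k → l}(A, E) = Attn(A, E) + MLP(Attn(A, E))`. -/
noncomputable def EncLayer.eval (φ : (Fin dH → ℝ) → Fin dK → ℝ) (P : EncLayer dH k l d d')
    (E : Finset (MultiIndex k n)) (E' : Finset (MultiIndex l n)) (A : Tensor k n d) :
    Tensor l n d' :=
  P.attn φ E E' A + P.mlp E' (P.attn φ E E' A)

end

/-- A composition of `t` second-order layers `Enc_{2 → 2}` (with head size `dH`) from `d` to `d'`
channels. -/
inductive EncStack (dH : ℕ) : ℕ → ℕ → ℕ → Type
  | nil (d : ℕ) : EncStack dH 0 d d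
  | cons {t d d' d'' : ℕ} (P : EncLayer dH 2 2 d d') (S : EncStack dH t d' d'') :
      EncStack dH (t + 1) d d''

/-- Evaluation of a stack of second-order layers on the edge set `E`, the first layer acting first. -/
noncomputable def EncStack.eval {dH dK n : ℕ} (φ : (Fin dH → ℝ) → Fin dK → ℝ)
    (E : Finset (MultiIndex 2 n)) :
    {t d d' : ℕ} → EncStack dH t d d' → Tensor 2 n d → Tensor 2 n d'
  | _, _, _, .nil _, A => A
  | _, _, _, .cons P S, A => S.eval φ E (P.eval φ E E A)

/-- A second-order sparse Transformer: `t` layers `Enc_{2 → 2}` and an output linear projection. -/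
structure SparseTransformer (dH t d dOut : ℕ) where
  width : ℕ
  layers : EncStack dH t d width
  proj : Matrix (Fin width) (Fin dOut) ℝ

/-! ### Graphs with features as second-order tensors -/

/-- The edge set augmented by all the self-loops, which represent the nodes. -/
def withLoops {n : ℕ} (E : Finset (MultiIndex 2 n)) : Finset (MultiIndex 2 n) :=
  E ∪ Finset.univ.image fun a : Fin n => ![a, a]

/-- The tensor `𝐀_{ij} = (𝐗_i, 𝐗_j, 𝐄_{ij})`; the edge channels are zero where there is no edge. -/
def encodeGraph {n dv de : ℕ} (E : Finset (MultiIndex 2 n)) (X : Fin n → Fin dv → ℝ)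
    (F : MultiIndex 2 n → Fin de → ℝ) : Tensor 2 n (dv + dv + de) := fun i =>
  Fin.append (Fin.append (X (i 0)) (X (i 1))) (if i ∈ E then F i else 0)

/-- The node features computed by a second-order sparse Transformer with kernel feature map `φ` from
a graph with edges `E`, node features `X` and edge features `F`: they are read off the diagonal. -/
noncomputable def SparseTransformer.eval {dH dK t dv de dOut n : ℕ}
    (φ : (Fin dH → ℝ) → Fin dK → ℝ) (S : SparseTransformer dH t (dv + dv + de) dOut)
    (E : Finset (MultiIndex 2 n)) (X : Fin n → Fin dv → ℝ) (F : MultiIndex 2 n → Fin de → ℝ) :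
    Fin n → Fin dOut → ℝ := fun j =>
  Matrix.vecMul (S.layers.eval φ (withLoops E) (encodeGraph E X F) ![j, j]) S.proj

/-! ### Message-passing neural networks -/

/-- A message passing step: a message function `M` and an update function `U`. -/
structure MPStep (de d d' : ℕ) where
  dm : ℕ
  M : (Fin d → ℝ) → (Fin d → ℝ) → (Fin de → ℝ) → Fin dm → ℝ
  U : (Fin d → ℝ) → (Fin dm → ℝ) → Fin d' → ℝ

/-- `𝐌_j = ∑_{i : (i,j) ∈ E} M(𝐗_j, 𝐗_i, 𝐄_{ij})` and `𝐇_j = U(𝐗_j, 𝐌_j)`. -/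
def MPStep.eval {de d d' n : ℕ} (P : MPStep de d d') (E : Finset (MultiIndex 2 n))
    (F : MultiIndex 2 n → Fin de → ℝ) (X : Fin n → Fin d → ℝ) : Fin n → Fin d' → ℝ := fun j =>
  P.U (X j) (∑ i : Fin n with ![i, j] ∈ E, P.M (X j) (X i) (F ![i, j]))

/-- Joint continuity of the message and the update function. -/
def MPStep.IsContinuous {de d d' : ℕ} (P : MPStep de d d') : Prop :=
  Continuous (fun p : (Fin d → ℝ) × (Fin d → ℝ) × (Fin de → ℝ) => P.M p.1 p.2.1 p.2.2) ∧
    Continuous (fun p : (Fin d → ℝ) × (Fin P.dm → ℝ) => P.U p.1 p.2)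

/-- A message-passing neural network with `T` message passing steps, each with its own message and
update functions. -/
inductive MPNN (de : ℕ) : ℕ → ℕ → ℕ → Type
  | nil (d : ℕ) : MPNN de 0 d d
  | cons {T d d' d'' : ℕ} (P : MPStep de d d') (N : MPNN de T d' d'') : MPNN de (T + 1) d d''

/-- The node features computed by a message-passing network, the first step acting first. -/
def MPNN.eval {de n : ℕ} (E : Finset (MultiIndex 2 n)) (F : MultiIndex 2 n → Fin de → ℝ) :
    {T d d' : ℕ} → MPNN de T d d' → (Fin n → Fin d → ℝ) → Fin n → Fin d' → ℝ
  | _, _, _, .nil _, X => X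
  | _, _, _, .cons P N, X => N.eval E F (P.eval E F X)

/-- All the message and update functions of the network are continuous. -/
def MPNN.IsContinuous {de : ℕ} : {T d d' : ℕ} → MPNN de T d d' → Prop
  | _, _, _, .nil _ => True
  | _, _, _, .cons P N => P.IsContinuous ∧ N.IsContinuous

/-! Constant queries and keys `x` with `φ x ≠ 0` make every attention coefficient equal to the
positive number `φ x ⬝ᵥ φ x`, which the output weights can cancel. Attention then becomes an
arbitrary sparse equivariant linear map `A ↦ ∑ i ∈ E, A i * T μ(i, j)`, still summing over all of
`E` (`EncLayer.ofLinear_attn`). With entrywise layers in the MLP, universal approximation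
(`exists_reluNetwork_approx`) lets one layer approximate `sparseMap L G` for any continuous `G`
(`layerApproximable_sparseMap`).

A message passing step is exactly two such maps (`updateMap_messageMap`): one computes the message
on every edge, the other sums the incoming messages and updates. The entry at `(i, j)` always holds
the features of `i`, of `j` and of the edge, so the steps can be iterated. Errors are controlled by
uniform continuity on compact sets, uniformly over the finitely many graphs on at most `n₀` nodes
(`LayerApproximable.cons`).

For the converse, message passing at a node depends only on the node features in its connected
component (`MPNN.eval_eq_of_eqOn_component`), whereas a single attention layer can sum a feature
over all other nodes. Changing one feature from `1` to `-1` in another component moves the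
Transformer output by `2` and leaves the network output at the node unchanged, so one of the two
errors is at least `1`. -/

/-! ### Approximation by ReLU networks with one hidden layer -/

/-- The span of the ridge functions `x ↦ ReLU(⟨v, x⟩ + b)`. -/
noncomputable def reluSpan (w : ℕ) : Submodule ℝ ((Fin w → ℝ) → ℝ) :=
  Submodule.span ℝ (Set.range fun (p : (Fin w → ℝ) × ℝ) x => max (x ⬝ᵥ p.1 + p.2) 0)

/-- The span of the functions `t ↦ ReLU(a t + b)` on the real line. -/
noncomputable def hingeSpan : Submodule ℝ (ℝ → ℝ) :=
  Submodule.span ℝ (Set.range fun (p : ℝ × ℝ) t => max (p.1 * t + p.2) 0)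

theorem hinge_mem_hingeSpan (a b : ℝ) : (fun t => max (a * t + b) 0) ∈ hingeSpan :=
  Submodule.subset_span ⟨(a, b), rfl⟩

theorem hingeSpan_comp_dotProduct {w : ℕ} {f : ℝ → ℝ} (hf : f ∈ hingeSpan) (v : Fin w → ℝ) :
    (fun x => f (x ⬝ᵥ v)) ∈ reluSpan w := by
  have h : hingeSpan ≤ (reluSpan w).comap (LinearMap.funLeft ℝ ℝ fun x : Fin w → ℝ => x ⬝ᵥ v) := by
    refine Submodule.span_le.2 ?_
    rintro _ ⟨p, rfl⟩
    refine Submodule.subset_span ⟨(p.1 • v, p.2), ?_⟩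
    funext x
    simp [LinearMap.funLeft, dotProduct_smul]
  exact h hf

/-- Piecewise linear interpolation, one grid cell per induction step. A difference of two hinges is
a ramp that vanishes left of the new cell and is constant right of it; constancy past the right end
is the invariant that lets the next ramp start from the correct value. One `ε` pays for the
oscillation of `g` in a cell, the other for the ramp. -/
theorem exists_hingeSpan_approx_grid {g : ℝ → ℝ} {s h ε : ℝ} (hh : 0 < h) (N : ℕ)
    (hg : ∀ t ∈ Set.Icc s (s + N * h), ∀ t' ∈ Set.Icc s (s + N * h), |t - t'| ≤ h →
      |g t - g t'| ≤ ε) :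
    ∃ f ∈ hingeSpan, (∀ t ∈ Set.Icc s (s + N * h), |f t - g t| ≤ 2 * ε) ∧
      ∀ t, s + N * h ≤ t → f t = g (s + N * h) := by
  induction N with
  | zero =>
    refine ⟨g s • fun t => max (0 * t + 1) 0, Submodule.smul_mem _ _ (hinge_mem_hingeSpan 0 1),
      ?_, ?_⟩
    · intro t ht
      have hts : t = s := by simpa using ht
      have := hg s (by simp) s (by simp) (by simpa using hh.le)
      have h0 : 0 ≤ ε := by simpa using this
      simp [hts, h0]
    · intro t _
      simp
  | succ N ih =>
    set u : ℝ := s + N * h with hu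
    have hu' : s + ((N + 1 : ℕ) : ℝ) * h = u + h := by push_cast; rw [hu]; ring
    rw [hu'] at hg ⊢
    have hsu : s ≤ u := by rw [hu]; nlinarith [Nat.cast_nonneg (α := ℝ) N]
    obtain ⟨f, hf, hfg, hfc⟩ := ih fun t ht t' ht' => hg t ⟨ht.1, by linarith [ht.2]⟩ t'
      ⟨ht'.1, by linarith [ht'.2]⟩
    set q : ℝ := (g (u + h) - g u) / h with hq
    have hqh : q * h = g (u + h) - g u := div_mul_cancel₀ _ hh.ne'
    refine ⟨f + q • ((fun t => max (1 * t + -u) 0) - fun t => max (1 * t + -(u + h)) 0),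
      add_mem hf (Submodule.smul_mem _ _ (sub_mem (hinge_mem_hingeSpan _ _)
        (hinge_mem_hingeSpan _ _))), ?_, ?_⟩
    · intro t ht
      rcases le_total t u with htu | hut
      · have h1 : max (1 * t + -u) 0 = 0 := max_eq_right (by linarith)
        have h2 : max (1 * t + -(u + h)) 0 = 0 := max_eq_right (by linarith)
        simpa only [Pi.add_apply, Pi.smul_apply, Pi.sub_apply, h1, h2, sub_self, smul_zero,
          add_zero] using hfg t ⟨ht.1, htu⟩
      · have h1 : max (1 * t + -u) 0 = t - u := by rw [max_eq_left] <;> linarith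
        have h2 : max (1 * t + -(u + h)) 0 = 0 := max_eq_right (by linarith [ht.2])
        have e1 := hg u ⟨hsu, by linarith⟩ t ht (by rw [abs_le]; constructor <;> linarith [ht.2])
        have e2 := hg (u + h) ⟨by linarith, le_rfl⟩ u ⟨hsu, by linarith⟩
          (by rw [add_sub_cancel_left, abs_of_pos hh])
        have e3 : |q * (t - u)| ≤ ε := by
          rw [abs_mul, abs_of_nonneg (sub_nonneg.2 hut)]
          calc |q| * (t - u) ≤ |q| * h := by gcongr; linarith [ht.2]
            _ = |q * h| := by rw [abs_mul, abs_of_pos hh]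
            _ ≤ ε := by rw [hqh]; exact e2
        have : (f + q • ((fun t => max (1 * t + -u) 0) - fun t => max (1 * t + -(u + h)) 0)) t - g t
            = (g u - g t) + q * (t - u) := by
          simp only [Pi.add_apply, Pi.smul_apply, Pi.sub_apply, h1, h2, hfc t hut, smul_eq_mul]
          ring
        rw [this]
        linarith [abs_add_le (g u - g t) (q * (t - u))]
    · intro t ht
      have h1 : max (1 * t + -u) 0 = t - u := by rw [max_eq_left] <;> linarith
      have h2 : max (1 * t + -(u + h)) 0 = t - (u + h) := by rw [max_eq_left] <;> linarith
      simp only [Pi.add_apply, Pi.smul_apply, Pi.sub_apply, h1, h2, hfc t (by linarith),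
        smul_eq_mul]
      linarith

theorem exists_hingeSpan_approx {g : ℝ → ℝ} (hg : Continuous g) (B : ℝ) {ε : ℝ} (hε : 0 < ε) :
    ∃ f ∈ hingeSpan, ∀ t, |t| ≤ B → |f t - g t| < ε := by
  rcases lt_or_ge B 0 with hB | hB
  · exact ⟨0, zero_mem _, fun t ht => absurd ht (by linarith [abs_nonneg t])⟩
  -- The right end is `B + 1` so that the interval, hence the grid step, has positive length even
  -- for `B = 0`.
  have huc : UniformContinuousOn g (Set.Icc (-B) (B + 1)) :=
    isCompact_Icc.uniformContinuousOn_of_continuous hg.continuousOn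
  obtain ⟨δ, hδ, hgδ⟩ := Metric.uniformContinuousOn_iff.1 huc (ε / 3) (by positivity)
  obtain ⟨N, hN⟩ := exists_nat_gt ((2 * B + 1) / δ)
  have hN0 : (0 : ℝ) < N := lt_of_le_of_lt (by positivity) hN
  have hNh : (N : ℝ) * ((2 * B + 1) / N) = 2 * B + 1 := mul_div_cancel₀ _ hN0.ne'
  have hend : -B + N * ((2 * B + 1) / N) = B + 1 := by rw [hNh]; ring
  obtain ⟨f, hf, hfg, -⟩ := exists_hingeSpan_approx_grid (g := g) (s := -B)
    (h := (2 * B + 1) / N) (ε := ε / 3) (by positivity) N (by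
      rw [hend]
      intro t ht t' ht' htt
      refine (hgδ t ht t' ht' (lt_of_le_of_lt htt ?_)).le
      rw [div_lt_iff₀ hN0]
      rw [div_lt_iff₀ hδ] at hN
      linarith)
  rw [hend] at hfg
  refine ⟨f, hf, fun t ht => ?_⟩
  have := hfg t ⟨(abs_le.1 ht).1, by linarith [(abs_le.1 ht).2]⟩
  linarith

/-- The exponentials `x ↦ exp ⟨x, v⟩` separate points and are closed under products, so by
Stone–Weierstrass their linear span is dense. Each depends on `x` only through `⟨x, v⟩`, which
reduces its approximation to one variable. -/
theorem exists_reluSpan_approx {w : ℕ} {g : (Fin w → ℝ) → ℝ} (hg : Continuous g) (B : ℝ) {ε : ℝ}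
    (hε : 0 < ε) : ∃ f ∈ reluSpan w, ∀ x, ‖x‖ ≤ B → |f x - g x| < ε := by
  let K := Metric.closedBall (0 : Fin w → ℝ) B
  have : CompactSpace K := isCompact_iff_compactSpace.1 (isCompact_closedBall _ _)
  let expHom : Multiplicative (Fin w → ℝ) →* C(K, ℝ) :=
    { toFun := fun v => ⟨fun x => Real.exp ((x : Fin w → ℝ) ⬝ᵥ v.toAdd),
        (continuous_subtype_val.dotProduct continuous_const).rexp⟩
      map_one' := by ext x; simp
      map_mul' := fun u v => by ext x; simp [dotProduct_add, Real.exp_add] }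
  have hexp : ∀ v, ∀ ε > 0, ∃ f ∈ reluSpan w, ∀ x : K, |f x - expHom v x| < ε := by
    intro v ε hε
    have hbd : Bornology.IsBounded ((fun x : Fin w → ℝ => x ⬝ᵥ v.toAdd) '' K) :=
      ((isCompact_closedBall _ _).image (continuous_id.dotProduct continuous_const)).isBounded
    obtain ⟨C, hC⟩ := hbd.exists_norm_le
    obtain ⟨f, hf, hfe⟩ := exists_hingeSpan_approx Real.continuous_exp C hε
    exact ⟨_, hingeSpan_comp_dotProduct hf v.toAdd, fun x => hfe _ (hC _ ⟨x, x.2, rfl⟩)⟩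
  let 𝒜 := Algebra.adjoin ℝ (MonoidHom.mrange expHom : Set C(K, ℝ))
  have h𝒜 : ∀ h ∈ 𝒜, ∀ ε > 0, ∃ f ∈ reluSpan w, ∀ x : K, |f x - h x| < ε := by
    intro h hh
    -- The generators form a monoid, so the algebra they generate is their linear span and no
    -- products of approximations arise.
    have hh' : h ∈ Submodule.span ℝ (MonoidHom.mrange expHom : Set C(K, ℝ)) := by
      have : h ∈ Subalgebra.toSubmodule 𝒜 := hh
      rwa [Algebra.adjoin_eq_span, Submonoid.closure_eq] at this
    clear hh
    induction hh' using Submodule.span_induction with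
    | mem h hh =>
      obtain ⟨v, rfl⟩ := hh
      exact hexp v
    | zero => exact fun ε hε => ⟨0, zero_mem _, fun x => by simpa using hε⟩
    | add h₁ h₂ _ _ ih₁ ih₂ =>
      intro ε hε
      obtain ⟨f₁, hf₁, h1⟩ := ih₁ (ε / 2) (by positivity)
      obtain ⟨f₂, hf₂, h2⟩ := ih₂ (ε / 2) (by positivity)
      refine ⟨f₁ + f₂, add_mem hf₁ hf₂, fun x => ?_⟩
      have : (f₁ + f₂) x - (h₁ + h₂) x = (f₁ x - h₁ x) + (f₂ x - h₂ x) := by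
        simp only [Pi.add_apply, ContinuousMap.add_apply]; ring
      rw [this]
      linarith [abs_add_le (f₁ x - h₁ x) (f₂ x - h₂ x), h1 x, h2 x]
    | smul a h _ ih =>
      intro ε hε
      obtain ⟨f, hf, h1⟩ := ih (ε / (|a| + 1)) (by positivity)
      refine ⟨a • f, Submodule.smul_mem _ _ hf, fun x => ?_⟩
      have : (a • f) x - (a • h) x = a * (f x - h x) := by
        simp only [Pi.smul_apply, ContinuousMap.smul_apply, smul_eq_mul]; ring
      rw [this, abs_mul]
      have h2 := h1 x
      rw [lt_div_iff₀ (by positivity)] at h2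
      nlinarith [abs_nonneg (f x - h x), abs_nonneg a]
  have hsep : 𝒜.SeparatesPoints := by
    intro x y hxy
    obtain ⟨c, hc⟩ : ∃ c, (x : Fin w → ℝ) c ≠ (y : Fin w → ℝ) c := by
      by_contra! h
      exact hxy (Subtype.ext (funext h))
    refine ⟨_, ⟨expHom (Multiplicative.ofAdd (Pi.single c 1)),
      Algebra.subset_adjoin ⟨_, rfl⟩, rfl⟩, ?_⟩
    simpa [expHom] using hc
  have htop := ContinuousMap.subalgebra_topologicalClosure_eq_top_of_separatesPoints 𝒜 hsep
  have hmem : (⟨fun x : K => g x, by fun_prop⟩ : C(K, ℝ)) ∈ closure (𝒜 : Set C(K, ℝ)) := by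
    rw [← Subalgebra.topologicalClosure_coe, htop]; trivial
  obtain ⟨p, hp, hgp⟩ := Metric.mem_closure_iff.1 hmem (ε / 2) (by positivity)
  obtain ⟨f, hf, hfp⟩ := h𝒜 p hp (ε / 2) (by positivity)
  refine ⟨f, hf, fun x hx => ?_⟩
  have hx' : x ∈ K := by simpa [K] using hx
  have h1 := hfp ⟨x, hx'⟩
  have h2 := (ContinuousMap.dist_apply_le_dist ⟨x, hx'⟩).trans_lt hgp
  rw [dist_comm, Real.dist_eq] at h2
  have : f x - g x = (f x - p ⟨x, hx'⟩) + (p ⟨x, hx'⟩ - g x) := by ring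
  rw [this]
  exact (abs_add_le _ _).trans_lt (by simp only [ContinuousMap.coe_mk] at h1 h2; linarith)

/-- ReLU networks with one hidden layer approximate continuous maps uniformly on bounded sets. -/
theorem exists_reluNetwork_approx {w w' : ℕ} {G : (Fin w → ℝ) → Fin w' → ℝ} (hG : Continuous G)
    (B : ℝ) {ε : ℝ} (hε : 0 < ε) :
    ∃ (m : ℕ) (W₁ : Matrix (Fin w) (Fin m) ℝ) (b : Fin m → ℝ) (W₂ : Matrix (Fin m) (Fin w') ℝ),
      ∀ x, ‖x‖ ≤ B →
        ‖Matrix.vecMul (fun k => max ((Matrix.vecMul x W₁ + b) k) 0) W₂ - G x‖ < ε := by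
  classical
  have h : ∀ c : Fin w', ∃ a : (Fin w → ℝ) × ℝ →₀ ℝ, ∀ x, ‖x‖ ≤ B →
      |a.sum (fun p r => r * max (x ⬝ᵥ p.1 + p.2) 0) - G x c| < ε := by
    intro c
    obtain ⟨f, hf, hfg⟩ := exists_reluSpan_approx (g := fun x => G x c) (by fun_prop) B hε
    obtain ⟨a, rfl⟩ := (Finsupp.mem_span_range_iff_exists_finsupp).1 hf
    refine ⟨a, fun x hx => ?_⟩
    simpa [Finsupp.sum, Finset.sum_apply] using hfg x hx
  choose a ha using h
  -- All output coordinates share one hidden layer: the union of the units they use, with zero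
  -- weight where a unit is not needed.
  let s := Finset.univ.biUnion fun c => (a c).support
  let e := s.equivFin
  refine ⟨s.card, Matrix.of fun r k => (e.symm k : (Fin w → ℝ) × ℝ).1 r,
    fun k => (e.symm k : (Fin w → ℝ) × ℝ).2,
    Matrix.of fun k c => a c (e.symm k : (Fin w → ℝ) × ℝ), fun x hx => ?_⟩
  rw [pi_norm_lt_iff hε]
  intro c
  rw [Pi.sub_apply, Real.norm_eq_abs]
  convert ha c x hx using 3
  rw [Finsupp.sum_of_support_subset (s := s) _ (Finset.subset_biUnion_of_mem (fun c => (a c).support)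
    (Finset.mem_univ c)) _ (by simp), ← Finset.sum_coe_sort s, ← e.symm.sum_comp]
  simp only [Matrix.vecMul, dotProduct, Matrix.of_apply, Pi.add_apply]
  exact Finset.sum_congr rfl fun k _ => mul_comm _ _

/-! ### Sparse equivariant layers in closed form -/

/-- Each pair `(i, j)` belongs to exactly one class, its equality pattern. -/
theorem sum_basisB_smul {k l n d' : ℕ} (E : Finset (MultiIndex k n)) (j : MultiIndex l n)
    (g : PairClass k l → MultiIndex k n → Fin d' → ℝ) :
    ∑ μ : PairClass k l, ∑ i ∈ E, basisB μ i j • g μ i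
      = ∑ i ∈ E, g (Setoid.ker (Sum.elim i j)) i := by
  classical
  rw [Finset.sum_comm]
  refine Finset.sum_congr rfl fun i _ => ?_
  rw [Finset.sum_eq_single (Setoid.ker (Sum.elim i j))]
  · simp [basisB, PairClass.Mem]
  · intro μ _ hμ
    simp [basisB, PairClass.Mem, hμ.symm]
  · simp

theorem sum_basisC_smul {l n d : ℕ} (j : MultiIndex l n) (b : Fin d → ℝ) :
    ∑ lam : IdxClass l, basisC lam j • b = b := by
  classical
  rw [Finset.sum_eq_single (Setoid.ker j)]
  · simp [basisC, IdxClass.Mem]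
  · intro μ _ hμ
    simp [basisC, IdxClass.Mem, hμ.symm]
  · simp

/-- The constant sparse layer with value `b`. -/
def LightLinear.const (k l d : ℕ) {d' : ℕ} (b : Fin d' → ℝ) : LightLinear k l d d' where
  weight _ := 0
  bias _ := b

theorem LightLinear.const_eval {k l d d' n : ℕ} (b : Fin d' → ℝ) {E : Finset (MultiIndex k n)}
    {E' : Finset (MultiIndex l n)} (A : Tensor k n d) {j : MultiIndex l n} (hj : j ∈ E') :
    (LightLinear.const k l d b).eval E E' A j = b := by
  simp [LightLinear.eval, LightLinear.const, hj, sum_basisC_smul]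

open Classical in
/-- The sparse layer applying one affine map to every entry. -/
noncomputable def LightLinear.entrywise (k : ℕ) {d d' : ℕ} (W : Matrix (Fin d) (Fin d') ℝ)
    (b : Fin d' → ℝ) : LightLinear k k d d' where
  weight μ := if ∀ a, μ (Sum.inl a) (Sum.inr a) then W else 0
  bias _ := b

/-- The weight survives only on classes that identify position `a` of the input with position `a` of
the output, which forces `i = j`. These classes are all lightweight, so restricting the sum to
lightweight classes loses nothing. -/
theorem LightLinear.entrywise_eval {k d d' n : ℕ} (W : Matrix (Fin d) (Fin d') ℝ)
    (b : Fin d' → ℝ) {E : Finset (MultiIndex k n)} (A : Tensor k n d) {j : MultiIndex k n}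
    (hj : j ∈ E) :
    (LightLinear.entrywise k W b).eval E E A j = Matrix.vecMul (A j) W + b := by
  classical
  have hpos : ∀ μ : PairClass k k, (∀ a, μ (Sum.inl a) (Sum.inr a)) →
      (LightLinear.entrywise k W b).weight μ = W := fun _ h => if_pos h
  have hneg : ∀ μ : PairClass k k, (¬ ∀ a, μ (Sum.inl a) (Sum.inr a)) →
      (LightLinear.entrywise k W b).weight μ = 0 := fun _ h => if_neg h
  have hw : ∀ μ : PairClass k k, ¬ μ.Lightweight → (LightLinear.entrywise k W b).weight μ = 0 :=
    fun μ hμ => hneg μ fun h => hμ fun a => ⟨a, h a⟩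
  rw [LightLinear.eval, if_pos hj]
  congr 1
  · rw [Finset.sum_filter_of_ne, sum_basisB_smul E j fun μ i => Matrix.vecMul (A i)
      ((LightLinear.entrywise k W b).weight μ)]
    · rw [Finset.sum_eq_single j]
      · rw [hpos]
        intro a
        simp [Setoid.ker_def]
      · intro i _ hij
        rw [hneg, Matrix.vecMul_zero]
        intro h
        exact hij (funext fun a => by simpa [Setoid.ker_def] using h a)
      · exact fun h => absurd hj h
    · intro μ _ hμ
      by_contra hl
      exact hμ (by simp [hw μ hl])
  · exact sum_basisC_smul j b

/-- A layer with constant queries and keys `x`, whose attention is the sparse equivariant linear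
layer with weights `T`, scaled by `φ(x)ᵀ φ(x) r`. -/
noncomputable def EncLayer.ofLinear {dH d d' m : ℕ} (x : Fin dH → ℝ) (r : ℝ)
    (T : PairClass 2 2 → Matrix (Fin d) (Fin d') ℝ) (L₁ : LightLinear 2 2 d' m)
    (L₂ : LightLinear 2 2 m d') : EncLayer dH 2 2 d d' where
  heads := d
  query _ _ := LightLinear.const 2 2 d x
  key _ _ := LightLinear.const 2 2 d x
  wV h _ := Matrix.of fun a _ => if a = h then 1 else 0
  wO h μ := Matrix.of fun _ c => r / dH * T μ h c
  dF := m
  mlp₁ := L₁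
  mlp₂ := L₂

/-- Head `h` copies channel `h` into all `dH` slots and sends it through row `h` of `T`; the factor
`r / dH` undoes the copies and the attention coefficient. With one head per input channel, a small
head size imposes no rank bound on `T`. -/
theorem EncLayer.ofLinear_attn {dH dK d d' m n : ℕ} (hdH : 0 < dH)
    (φ : (Fin dH → ℝ) → Fin dK → ℝ) {x : Fin dH → ℝ} {r : ℝ} (hr : φ x ⬝ᵥ φ x * r = 1)
    (T : PairClass 2 2 → Matrix (Fin d) (Fin d') ℝ) (L₁ : LightLinear 2 2 d' m)
    (L₂ : LightLinear 2 2 m d') {E : Finset (MultiIndex 2 n)} (A : Tensor 2 n d)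
    {j : MultiIndex 2 n} (hj : j ∈ E) :
    (EncLayer.ofLinear x r T L₁ L₂).attn φ E E A j
      = ∑ i ∈ E, Matrix.vecMul (A i) (T (Setoid.ker (Sum.elim i j))) := by
  classical
  have hcoeff : ∀ h μ, ∀ i ∈ E, (EncLayer.ofLinear x r T L₁ L₂).coeff φ E E A h μ i j
      = basisB μ i j * (φ x ⬝ᵥ φ x) := by
    intro h μ i hi
    have hq : (LightLinear.const 2 2 d x).eval E E A j = x := LightLinear.const_eval x A hj
    have hk : (LightLinear.const 2 2 d x).eval E E A i = x := LightLinear.const_eval x A hi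
    by_cases hμ : μ.Mem i j
    · simp [EncLayer.coeff, EncLayer.ofLinear, basisB, hμ, hi, hj, hq, hk]
    · simp [EncLayer.coeff, basisB, hμ]
  have hdH' : (dH : ℝ) ≠ 0 := by exact_mod_cast hdH.ne'
  have hval : ∀ (h : Fin d) (μ : PairClass 2 2) (y : Fin d → ℝ),
      (φ x ⬝ᵥ φ x) • Matrix.vecMul (Matrix.vecMul y ((EncLayer.ofLinear x r T L₁ L₂).wV h μ))
        ((EncLayer.ofLinear x r T L₁ L₂).wO h μ) = fun c => y h * T μ h c := by
    intro h μ y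
    funext c
    simp only [EncLayer.ofLinear, Matrix.vecMul, dotProduct, Matrix.of_apply, Pi.smul_apply,
      mul_ite, mul_one, mul_zero, Finset.sum_ite_eq', Finset.mem_univ, if_true, Finset.sum_const,
      Finset.card_univ, Fintype.card_fin, smul_eq_mul, nsmul_eq_mul]
    rw [dotProduct] at hr
    calc _ = ((∑ i, φ x i * φ x i) * r) * (dH / dH) * (y h * T μ h c) := by ring
      _ = _ := by rw [hr, div_self hdH', one_mul, one_mul]
  rw [EncLayer.attn, if_pos hj]
  have step : ∀ h : Fin d, ∑ μ : PairClass 2 2, ∑ i ∈ E,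
      (EncLayer.ofLinear x r T L₁ L₂).coeff φ E E A h μ i j •
        Matrix.vecMul (Matrix.vecMul (A i) ((EncLayer.ofLinear x r T L₁ L₂).wV h μ))
          ((EncLayer.ofLinear x r T L₁ L₂).wO h μ)
      = ∑ i ∈ E, fun c => A i h * T (Setoid.ker (Sum.elim i j)) h c := by
    intro h
    rw [← sum_basisB_smul E j fun μ i c => A i h * T μ h c]
    refine Finset.sum_congr rfl fun μ _ => Finset.sum_congr rfl fun i hi => ?_
    rw [hcoeff h μ i hi, mul_smul, hval]
  refine (Finset.sum_congr rfl fun h _ => step h).trans ?_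
  refine Finset.sum_comm.trans (Finset.sum_congr rfl fun i _ => ?_)
  funext c
  exact Finset.sum_apply c _ _

theorem EncLayer.ofLinear_eval {dH dK d d' m n : ℕ} (hdH : 0 < dH)
    (φ : (Fin dH → ℝ) → Fin dK → ℝ) {x : Fin dH → ℝ} {r : ℝ} (hr : φ x ⬝ᵥ φ x * r = 1)
    (T : PairClass 2 2 → Matrix (Fin d) (Fin d') ℝ) (W₁ : Matrix (Fin d') (Fin m) ℝ)
    (b₁ : Fin m → ℝ) (W₂ : Matrix (Fin m) (Fin d') ℝ) (b₂ : Fin d' → ℝ)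
    {E : Finset (MultiIndex 2 n)} (A : Tensor 2 n d) {j : MultiIndex 2 n} (hj : j ∈ E) :
    (EncLayer.ofLinear x r T (.entrywise 2 W₁ b₁) (.entrywise 2 W₂ b₂)).eval φ E E A j
      = (∑ i ∈ E, Matrix.vecMul (A i) (T (Setoid.ker (Sum.elim i j))))
        + (Matrix.vecMul (fun k => max ((Matrix.vecMul
            (∑ i ∈ E, Matrix.vecMul (A i) (T (Setoid.ker (Sum.elim i j)))) W₁ + b₁) k) 0) W₂
          + b₂) := by
  rw [← EncLayer.ofLinear_attn hdH φ hr T (.entrywise 2 W₁ b₁) (.entrywise 2 W₂ b₂) A hj,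
    EncLayer.eval, Pi.add_apply]
  congr 1
  rw [EncLayer.mlp]
  refine (LightLinear.entrywise_eval W₂ b₂ _ hj).trans ?_
  congr 2
  funext k
  rw [← LightLinear.entrywise_eval W₁ b₁ _ hj]
  rfl

theorem EncLayer.eval_of_notMem {dH dK k l d d' n : ℕ} (φ : (Fin dH → ℝ) → Fin dK → ℝ)
    (P : EncLayer dH k l d d') (E : Finset (MultiIndex k n)) {E' : Finset (MultiIndex l n)}
    (A : Tensor k n d) {j : MultiIndex l n} (hj : j ∉ E') : P.eval φ E E' A j = 0 := by
  simp [EncLayer.eval, EncLayer.attn, EncLayer.mlp, LightLinear.eval, hj]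

/-! ### Families of tensor maps approximated by Transformers -/

/-- The family `f`, indexed by the number of nodes and the hyperedge set, is approximated, after
decoding the channels by linear maps, by Transformer layers with bounded outputs. -/
def LayerApproximable {dH dK : ℕ} (φ : (Fin dH → ℝ) → Fin dK → ℝ) {Y Z : Type}
    [NormedAddCommGroup Y] [NormedSpace ℝ Y] [NormedAddCommGroup Z] [NormedSpace ℝ Z]
    (f : ∀ n, Finset (MultiIndex 2 n) → (MultiIndex 2 n → Y) → MultiIndex 2 n → Z) : Prop :=
  ∀ (d : ℕ) (D : (Fin d → ℝ) →L[ℝ] Y) (n₀ : ℕ) (B ε : ℝ), 0 < ε →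
    ∃ (d' : ℕ) (P : EncLayer dH 2 2 d d') (D' : (Fin d' → ℝ) →L[ℝ] Z) (C : ℝ),
      ∀ n ≤ n₀, ∀ (E : Finset (MultiIndex 2 n)) (A : Tensor 2 n d), ‖A‖ ≤ B →
        ‖P.eval φ E E A‖ ≤ C ∧
          ‖(fun j => D' (P.eval φ E E A j)) - f n E (fun j => D (A j))‖ < ε

/-- The family `f` is approximated, after decoding the channels by linear maps, by stacks of `t`
Transformer layers. -/
def StackApproximable {dH dK : ℕ} (φ : (Fin dH → ℝ) → Fin dK → ℝ) (t : ℕ) {Y Z : Type}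
    [NormedAddCommGroup Y] [NormedSpace ℝ Y] [NormedAddCommGroup Z] [NormedSpace ℝ Z]
    (f : ∀ n, Finset (MultiIndex 2 n) → (MultiIndex 2 n → Y) → MultiIndex 2 n → Z) : Prop :=
  ∀ (d : ℕ) (D : (Fin d → ℝ) →L[ℝ] Y) (n₀ : ℕ) (B ε : ℝ), 0 < ε →
    ∃ (d' : ℕ) (S : EncStack dH t d d') (D' : (Fin d' → ℝ) →L[ℝ] Z),
      ∀ n ≤ n₀, ∀ (E : Finset (MultiIndex 2 n)) (A : Tensor 2 n d), ‖A‖ ≤ B →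
        ‖(fun j => D' (S.eval φ E A j)) - f n E (fun j => D (A j))‖ < ε

theorem StackApproximable.zero {dH dK : ℕ} (φ : (Fin dH → ℝ) → Fin dK → ℝ) {Y : Type}
    [NormedAddCommGroup Y] [NormedSpace ℝ Y] :
    StackApproximable φ 0 (fun n _ (A : MultiIndex 2 n → Y) => A) := fun d D n₀ B ε hε =>
  ⟨d, .nil d, D, fun n _ E A _ => by simpa [EncStack.eval] using hε⟩

open Classical in
/-- The family `A ↦ G (∑ i ∈ E, L μ(i, j) (A i))`, for `j ∈ E`. -/
noncomputable def sparseMap {Y V Z : Type} [NormedAddCommGroup Y] [NormedSpace ℝ Y]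
    [NormedAddCommGroup V] [NormedSpace ℝ V] [Zero Z] (L : PairClass 2 2 → Y →L[ℝ] V) (G : V → Z)
    (n : ℕ) (E : Finset (MultiIndex 2 n)) (A : MultiIndex 2 n → Y) (j : MultiIndex 2 n) : Z :=
  if j ∈ E then G (∑ i ∈ E, L (Setoid.ker (Sum.elim i j)) (A i)) else 0

theorem continuous_sparseMap {Y V Z : Type} [NormedAddCommGroup Y] [NormedSpace ℝ Y]
    [NormedAddCommGroup V] [NormedSpace ℝ V] [TopologicalSpace Z] [Zero Z]
    (L : PairClass 2 2 → Y →L[ℝ] V) {G : V → Z} (hG : Continuous G) (n : ℕ)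
    (E : Finset (MultiIndex 2 n)) : Continuous (sparseMap L G n E) := by
  refine continuous_pi fun j => ?_
  by_cases hj : j ∈ E
  · simp only [sparseMap, hj, if_true]
    fun_prop
  · simp only [sparseMap, hj, if_false]
    fun_prop

/-- The residual connection adds the attention output to the MLP output. Working in `V × Z` keeps
them apart: attention writes the linear sum into `V`, the MLP writes an approximation of `G` of it
into `Z`, and the decoder `D'` reads only `Z`. -/
theorem layerApproximable_sparseMap {dH dK : ℕ} (hdH : 0 < dH) (φ : (Fin dH → ℝ) → Fin dK → ℝ)
    (hφ : ∃ x, φ x ≠ 0) {Y V Z : Type} [NormedAddCommGroup Y] [NormedSpace ℝ Y]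
    [NormedAddCommGroup V] [NormedSpace ℝ V] [FiniteDimensional ℝ V]
    [NormedAddCommGroup Z] [NormedSpace ℝ Z] [FiniteDimensional ℝ Z]
    (L : PairClass 2 2 → Y →L[ℝ] V) {G : V → Z} (hG : Continuous G) :
    LayerApproximable φ (sparseMap L G) := by
  intro d D n₀ B ε hε
  obtain ⟨x, hx⟩ := hφ
  have hr : φ x ⬝ᵥ φ x * (φ x ⬝ᵥ φ x)⁻¹ = 1 :=
    mul_inv_cancel₀ fun h => hx (dotProduct_self_eq_zero.1 h)
  let w := Module.finrank ℝ (V × Z)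
  let e : (V × Z) ≃L[ℝ] (Fin w → ℝ) := ContinuousLinearEquiv.ofFinrankEq (by simp [w])
  let S : PairClass 2 2 → (Fin d → ℝ) →L[ℝ] (Fin w → ℝ) := fun μ =>
    (e : (V × Z) →L[ℝ] (Fin w → ℝ)) ∘L ContinuousLinearMap.inl ℝ V Z ∘L L μ ∘L D
  let T : PairClass 2 2 → Matrix (Fin d) (Fin w) ℝ := fun μ =>
    (LinearMap.toMatrix' (S μ : (Fin d → ℝ) →ₗ[ℝ] (Fin w → ℝ))).transpose
  have hT : ∀ μ y, Matrix.vecMul y (T μ) = S μ y := fun μ y => by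
    rw [Matrix.vecMul_transpose, LinearMap.toMatrix'_mulVec]; rfl
  let G' : (Fin w → ℝ) → Fin w → ℝ := fun y => e (0, G (e.symm y).1)
  have hG' : Continuous G' := by fun_prop
  let D' : (Fin w → ℝ) →L[ℝ] Z :=
    ContinuousLinearMap.snd ℝ V Z ∘L (e.symm : (Fin w → ℝ) →L[ℝ] V × Z)
  set B₁ : ℝ := (n₀ : ℝ) ^ 2 * ((∑ μ, ‖S μ‖) * |B|) with hB₁
  obtain ⟨C, hC⟩ := ((isCompact_closedBall (0 : Fin w → ℝ) B₁).image hG').isBounded.exists_norm_le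
  -- The bound `1` serves the a priori bound on the layer output, the other one the error after
  -- decoding.
  have hδ : 0 < min 1 (ε / (‖D'‖ + 1)) := lt_min one_pos (by positivity)
  obtain ⟨m, W₁, b, W₂, hW⟩ := exists_reluNetwork_approx hG' B₁ hδ
  refine ⟨w, .ofLinear x (φ x ⬝ᵥ φ x)⁻¹ T (.entrywise 2 W₁ b) (.entrywise 2 W₂ 0), D',
    B₁ + (C + 1) + |B₁ + (C + 1)|, fun n hn E A hA => ?_⟩
  have key : ∀ j ∈ E, ∃ a : Fin w → ℝ, ∃ u : Fin w → ℝ, ‖a‖ ≤ B₁ ∧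
      a = e (∑ i ∈ E, L (Setoid.ker (Sum.elim i j)) (D (A i)), 0) ∧
      ‖u - G' a‖ < min 1 (ε / (‖D'‖ + 1)) ∧
      (EncLayer.ofLinear x (φ x ⬝ᵥ φ x)⁻¹ T (.entrywise 2 W₁ b) (.entrywise 2 W₂ 0)).eval φ E E A j
        = a + u := by
    intro j hj
    have hae : ∑ i ∈ E, Matrix.vecMul (A i) (T (Setoid.ker (Sum.elim i j)))
        = e (∑ i ∈ E, L (Setoid.ker (Sum.elim i j)) (D (A i)), 0) := by
      have h0 : (∑ i ∈ E, L (Setoid.ker (Sum.elim i j)) (D (A i)), (0 : Z))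
          = ContinuousLinearMap.inl ℝ V Z (∑ i ∈ E, L (Setoid.ker (Sum.elim i j)) (D (A i))) := rfl
      rw [h0, map_sum, map_sum]
      exact Finset.sum_congr rfl fun i _ => hT _ _
    have hab : ‖∑ i ∈ E, Matrix.vecMul (A i) (T (Setoid.ker (Sum.elim i j)))‖ ≤ B₁ := by
      have hle : ∀ i ∈ E, ‖Matrix.vecMul (A i) (T (Setoid.ker (Sum.elim i j)))‖
          ≤ (∑ μ, ‖S μ‖) * |B| := by
        intro i _
        rw [hT]
        refine (ContinuousLinearMap.le_opNorm _ _).trans ?_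
        refine mul_le_mul ?_ ((norm_le_pi_norm A i).trans (hA.trans (le_abs_self B)))
          (norm_nonneg _) (Finset.sum_nonneg fun _ _ => norm_nonneg _)
        exact Finset.single_le_sum (f := fun μ => ‖S μ‖) (fun _ _ => norm_nonneg _)
          (Finset.mem_univ _)
      refine (norm_sum_le_of_le _ hle).trans ?_
      rw [Finset.sum_const, nsmul_eq_mul, hB₁]
      have hcard : E.card ≤ n₀ ^ 2 := by
        refine (Finset.card_le_univ E).trans ?_
        simpa [MultiIndex] using Nat.pow_le_pow_left hn 2
      have hS : 0 ≤ ∑ μ, ‖S μ‖ := Finset.sum_nonneg fun _ _ => norm_nonneg _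
      gcongr
      exact_mod_cast hcard
    exact ⟨_, _, hab, hae, hW _ hab, by rw [EncLayer.ofLinear_eval hdH φ hr T _ _ _ _ A hj, add_zero]⟩
  constructor
  · rw [pi_norm_le_iff_of_nonneg (by linarith [neg_abs_le (B₁ + (C + 1))])]
    intro j
    by_cases hj : j ∈ E
    · obtain ⟨a, u, ha, -, hu, he⟩ := key j hj
      have h1 := hC (G' a) ⟨a, by simpa using ha, rfl⟩
      have h2 := hu.trans_le (min_le_left _ _)
      have h3 : ‖u‖ ≤ ‖u - G' a‖ + ‖G' a‖ := by simpa using norm_add_le (u - G' a) (G' a)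
      rw [he]
      linarith [norm_add_le a u, abs_nonneg (B₁ + (C + 1))]
    · rw [EncLayer.eval_of_notMem φ _ E A hj, norm_zero]
      linarith [neg_abs_le (B₁ + (C + 1))]
  · rw [pi_norm_lt_iff hε]
    intro j
    by_cases hj : j ∈ E
    · obtain ⟨a, u, ha, hae, hu, he⟩ := key j hj
      have h1 : D' (a + u) - G (∑ i ∈ E, L (Setoid.ker (Sum.elim i j)) (D (A i)))
          = D' (u - G' a) := by
        have h2 : D' a = 0 := by simp [D', hae]
        have h3 : D' (G' a) = G (∑ i ∈ E, L (Setoid.ker (Sum.elim i j)) (D (A i))) := by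
          simp [D', G', hae]
        rw [map_add, map_sub, h2, h3, zero_add]
      simp only [Pi.sub_apply, sparseMap, hj, if_true, he]
      rw [h1]
      refine (ContinuousLinearMap.le_opNorm _ _).trans_lt ?_
      have h4 := hu.trans_le (min_le_right _ _)
      rw [lt_div_iff₀ (by positivity)] at h4
      nlinarith [norm_nonneg (u - G' a), norm_nonneg D']
    · simpa [sparseMap, hj, EncLayer.eval_of_notMem φ _ E A hj] using hε

theorem exists_pos_forall_of_fin {p : ∀ n, Finset (MultiIndex 2 n) → ℝ → Prop}
    (hp : ∀ n E, ∃ δ > 0, p n E δ) (hmono : ∀ n E δ δ', δ ≤ δ' → p n E δ' → p n E δ) (n₀ : ℕ) :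
    ∃ δ > 0, ∀ n ≤ n₀, ∀ E, p n E δ := by
  choose δ hδ hpδ using hp
  let f : (Σ n : Fin (n₀ + 1), Finset (MultiIndex 2 n)) → ℝ := fun q => δ q.1 q.2
  have : Nonempty (Σ n : Fin (n₀ + 1), Finset (MultiIndex 2 n)) := ⟨⟨0, ∅⟩⟩
  obtain ⟨q, hq⟩ := Finite.exists_min f
  exact ⟨f q, hδ _ _, fun n hn E =>
    hmono n E _ _ (hq ⟨⟨n, Nat.lt_succ_of_le hn⟩, E⟩) (hpδ n E)⟩

/-- The tolerance `δ` for the first layer comes from the exact map `g`, before any layer is chosen.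
The output bound `C` of that layer is then the input radius for the remaining stack, and each source
of error gets `ε / 2`. -/
theorem LayerApproximable.cons {dH dK t : ℕ} {φ : (Fin dH → ℝ) → Fin dK → ℝ} {Y V Z : Type}
    [NormedAddCommGroup Y] [NormedSpace ℝ Y] [NormedAddCommGroup V] [NormedSpace ℝ V]
    [NormedAddCommGroup Z] [NormedSpace ℝ Z]
    {f : ∀ n, Finset (MultiIndex 2 n) → (MultiIndex 2 n → Y) → MultiIndex 2 n → V}
    {g : ∀ n, Finset (MultiIndex 2 n) → (MultiIndex 2 n → V) → MultiIndex 2 n → Z}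
    (hf : LayerApproximable φ f) (hg : StackApproximable φ t g)
    (hfc : ∀ n E, Continuous (f n E)) (hgc : ∀ n E, Continuous (g n E)) :
    StackApproximable φ (t + 1) fun n E A => g n E (f n E A) := by
  intro d D n₀ B ε hε
  obtain ⟨δ, hδ, hδg⟩ := exists_pos_forall_of_fin
    (p := fun n E δ => ∀ A : Tensor 2 n d, ‖A‖ ≤ B → ∀ y,
      ‖y - f n E (fun j => D (A j))‖ < δ →
        ‖g n E y - g n E (f n E (fun j => D (A j)))‖ < ε / 2)
    (fun n E => by
      have hK : IsCompact ((fun A : Tensor 2 n d => f n E fun j => D (A j)) ''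
          Metric.closedBall 0 B) :=
        (isCompact_closedBall _ _).image ((hfc n E).comp (by fun_prop))
      -- Only one of the two points compared has to lie in the compact image; the approximate output
      -- `y` may lie outside it.
      have hu := hK.uniformContinuousAt_of_continuousAt (g n E)
        (fun a _ => (hgc n E).continuousAt) (Metric.dist_mem_uniformity (half_pos hε))
      obtain ⟨δ, hδ, hs⟩ := Metric.mem_uniformity_dist.1 hu
      refine ⟨δ, hδ, fun A hA y hy => ?_⟩
      have := hs (a := f n E fun j => D (A j)) (b := y) (by rwa [dist_comm, dist_eq_norm])
        ⟨A, by simpa using hA, rfl⟩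
      rw [← dist_eq_norm, dist_comm]
      exact this)
    (fun n E δ δ' h hp A hA y hy => hp A hA y (hy.trans_le h)) n₀
  obtain ⟨d₁, P, D₁, C, hP⟩ := hf d D n₀ B δ hδ
  obtain ⟨d₂, S, D₂, hS⟩ := hg d₁ D₁ n₀ C (ε / 2) (half_pos hε)
  refine ⟨d₂, .cons P S, D₂, fun n hn E A hA => ?_⟩
  obtain ⟨hb, hPA⟩ := hP n hn E A hA
  have h1 := hS n hn E _ hb
  have h2 := hδg n hn E A hA _ hPA
  calc _ = ‖((fun j => D₂ (S.eval φ E (P.eval φ E E A) j))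
            - g n E (fun j => D₁ (P.eval φ E E A j)))
          + (g n E (fun j => D₁ (P.eval φ E E A j)) - g n E (f n E fun j => D (A j)))‖ := by
        rw [sub_add_sub_cancel]; rfl
    _ < ε := (norm_add_le _ _).trans_lt (by linarith)

/-! ### Message passing by pairs of Transformer layers -/

/-- The features of the two endpoints and of the edge. -/
abbrev PairFeature (d de : ℕ) : Type := (Fin d → ℝ) × (Fin d → ℝ) × (Fin de → ℝ)

/-- The tensor with entries `(X i, X j, F (i, j))`. -/
def pairFeatures {n d de : ℕ} (E : Finset (MultiIndex 2 n)) (X : Fin n → Fin d → ℝ)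
    (F : MultiIndex 2 n → Fin de → ℝ) (i : MultiIndex 2 n) : PairFeature d de :=
  (X (i 0), X (i 1), if i ∈ E then F i else 0)

theorem pair_mem_withLoops {n : ℕ} (E : Finset (MultiIndex 2 n)) (a : Fin n) :
    ![a, a] ∈ withLoops E :=
  Finset.mem_union_right _ (Finset.mem_image_of_mem _ (Finset.mem_univ a))

/-- As `E` has no loops, discarding the diagonal recovers exactly the edges of `E`, and those
entering `a` are determined by their source. -/
theorem sum_withLoops_offDiag {n : ℕ} {β : Type*} [AddCommMonoid β] {E : Finset (MultiIndex 2 n)}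
    (hE : ∀ a, ![a, a] ∉ E) (a : Fin n) (m : MultiIndex 2 n → β) :
    ∑ i ∈ withLoops E with i 1 = a ∧ i 0 ≠ i 1, m i = ∑ k : Fin n with ![k, a] ∈ E, m ![k, a] := by
  have hvec : ∀ i : MultiIndex 2 n, ![i 0, i 1] = i := fun i => by
    funext c; fin_cases c <;> rfl
  symm
  refine Finset.sum_nbij' (fun k => ![k, a]) (fun i => i 0) ?_ ?_ ?_ ?_ ?_
  · intro k hk
    have hk' : ![k, a] ∈ E := by simpa using hk
    have hka : k ≠ a := fun h => hE a (by rwa [h] at hk')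
    simp [withLoops, hk', hka]
  · intro i hi
    obtain ⟨hi, hia, hne⟩ := Finset.mem_filter.1 hi
    rcases Finset.mem_union.1 hi with h | h
    · simpa [← hia, hvec] using h
    · obtain ⟨b, -, rfl⟩ := Finset.mem_image.1 h
      exact absurd rfl hne
  · intro k _
    rfl
  · intro i hi
    rw [← (Finset.mem_filter.1 hi).2.1, hvec]
  · intro k _
    rfl

open Classical in
/-- The weights of the layer that keeps every entry. -/
noncomputable def keepWeight (Y : Type) [NormedAddCommGroup Y] [NormedSpace ℝ Y]
    (μ : PairClass 2 2) : Y →L[ℝ] Y :=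
  (if ∀ a, μ (Sum.inl a) (Sum.inr a) then (1 : ℝ) else 0) • ContinuousLinearMap.id ℝ Y

open Classical in
/-- The weights of the layer that sums the off-diagonal entries `(k, i)` over `k`, where `i` is the
endpoint of the output index at position `b`. -/
noncomputable def gatherWeight (Y : Type) [NormedAddCommGroup Y] [NormedSpace ℝ Y] (b : Fin 2)
    (μ : PairClass 2 2) : Y →L[ℝ] Y :=
  (if μ (Sum.inl 1) (Sum.inr b) ∧ ¬ μ (Sum.inl 0) (Sum.inl 1) then (1 : ℝ) else 0) •
    ContinuousLinearMap.id ℝ Y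

theorem sum_keepWeight {n : ℕ} {Y : Type} [NormedAddCommGroup Y] [NormedSpace ℝ Y]
    {E : Finset (MultiIndex 2 n)} (A : MultiIndex 2 n → Y) {j : MultiIndex 2 n} (hj : j ∈ E) :
    ∑ i ∈ E, keepWeight Y (Setoid.ker (Sum.elim i j)) (A i) = A j := by
  rw [Finset.sum_eq_single_of_mem j hj]
  · simp [keepWeight, Setoid.ker_def]
  · intro i _ hij
    have : ¬ ∀ a, i a = j a := fun h => hij (funext h)
    simp [keepWeight, Setoid.ker_def, this]

theorem sum_gatherWeight {n : ℕ} {Y : Type} [NormedAddCommGroup Y] [NormedSpace ℝ Y]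
    {E : Finset (MultiIndex 2 n)} (hE : ∀ a, ![a, a] ∉ E) (b : Fin 2) (A : MultiIndex 2 n → Y)
    (j : MultiIndex 2 n) :
    ∑ i ∈ withLoops E, gatherWeight Y b (Setoid.ker (Sum.elim i j)) (A i)
      = ∑ k : Fin n with ![k, j b] ∈ E, A ![k, j b] := by
  classical
  rw [← sum_withLoops_offDiag hE, Finset.sum_filter]
  refine Finset.sum_congr rfl fun i _ => ?_
  simp only [gatherWeight, Setoid.ker_def, Sum.elim_inl, Sum.elim_inr]
  by_cases h : i 1 = j b ∧ i 0 ≠ i 1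
  · rw [if_pos h, if_pos h, one_smul, ContinuousLinearMap.id_apply]
  · rw [if_neg h, if_neg h, zero_smul, zero_apply]

/-- The first of the two layers for a message passing step computes the messages. -/
noncomputable def messageMap {de d d' : ℕ} (P : MPStep de d d') :
    ∀ n, Finset (MultiIndex 2 n) → (MultiIndex 2 n → PairFeature d de) → MultiIndex 2 n →
      PairFeature d de × (Fin P.dm → ℝ) :=
  sparseMap (keepWeight (PairFeature d de)) fun v => (v, P.M v.2.1 v.1 v.2.2)

/-- The second of the two layers for a message passing step aggregates and updates. -/
noncomputable def updateMap {de d d' : ℕ} (P : MPStep de d d') :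
    ∀ n, Finset (MultiIndex 2 n) → (MultiIndex 2 n → PairFeature d de × (Fin P.dm → ℝ)) →
      MultiIndex 2 n → PairFeature d' de :=
  sparseMap
    (fun μ => (keepWeight (PairFeature d de) μ ∘L ContinuousLinearMap.fst ℝ _ _).prod
      ((gatherWeight (Fin P.dm → ℝ) 0 μ ∘L ContinuousLinearMap.snd ℝ _ _).prod
        (gatherWeight (Fin P.dm → ℝ) 1 μ ∘L ContinuousLinearMap.snd ℝ _ _)))
    fun v => (P.U v.1.1 v.2.1, P.U v.1.2.1 v.2.2, v.1.2.2)

theorem MPStep.IsContinuous.continuous_message {de d d' : ℕ} {P : MPStep de d d'}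
    (hP : P.IsContinuous) :
    Continuous fun v : PairFeature d de => (v, P.M v.2.1 v.1 v.2.2) :=
  continuous_id.prodMk (hP.1.comp (f := fun v : PairFeature d de => (v.2.1, v.1, v.2.2))
    (by fun_prop))

theorem MPStep.IsContinuous.continuous_update {de d d' : ℕ} {P : MPStep de d d'}
    (hP : P.IsContinuous) :
    Continuous fun v : PairFeature d de × (Fin P.dm → ℝ) × (Fin P.dm → ℝ) =>
      ((P.U v.1.1 v.2.1, P.U v.1.2.1 v.2.2, v.1.2.2) : PairFeature d' de) :=
  (hP.2.comp (f := fun v : PairFeature d de × (Fin P.dm → ℝ) × (Fin P.dm → ℝ) =>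
    (v.1.1, v.2.1)) (by fun_prop)).prodMk
    ((hP.2.comp (f := fun v : PairFeature d de × (Fin P.dm → ℝ) × (Fin P.dm → ℝ) =>
      (v.1.2.1, v.2.2)) (by fun_prop)).prodMk (by fun_prop))

/-- Both endpoints stored at `j` must be updated, so messages are gathered at `j 0` and at `j 1`.
Values computed on the added loops are never gathered. Agreement is asked only on `withLoops E`,
since sparse layers vanish elsewhere while the encoded input need not. -/
theorem updateMap_messageMap {n de d d' : ℕ} (P : MPStep de d d') {E : Finset (MultiIndex 2 n)}
    (hE : ∀ a, ![a, a] ∉ E) (X : Fin n → Fin d → ℝ) (F : MultiIndex 2 n → Fin de → ℝ)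
    {A : MultiIndex 2 n → PairFeature d de} (hA : ∀ j ∈ withLoops E, A j = pairFeatures E X F j)
    {j : MultiIndex 2 n} (hj : j ∈ withLoops E) :
    updateMap P n (withLoops E) (messageMap P n (withLoops E) A) j
      = pairFeatures E (P.eval E F X) F j := by
  have hm : ∀ i ∈ withLoops E, messageMap P n (withLoops E) A i
      = (pairFeatures E X F i, P.M (X (i 1)) (X (i 0)) (if i ∈ E then F i else 0)) := by
    intro i hi
    simp only [messageMap, sparseMap, hi, if_true, sum_keepWeight A hi, hA i hi]
    rfl
  have hs : ∀ b, ∑ i ∈ withLoops E, gatherWeight (Fin P.dm → ℝ) b (Setoid.ker (Sum.elim i j))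
      (messageMap P n (withLoops E) A i).2
      = ∑ k : Fin n with ![k, j b] ∈ E, P.M (X (j b)) (X k) (F ![k, j b]) := by
    intro b
    rw [sum_gatherWeight hE b (fun i => (messageMap P n (withLoops E) A i).2)]
    refine Finset.sum_congr rfl fun k hk => ?_
    have hk' : ![k, j b] ∈ E := (Finset.mem_filter.1 hk).2
    rw [hm _ (Finset.mem_union_left _ hk'), if_pos hk']
    rfl
  have hk : ∑ i ∈ withLoops E, keepWeight (PairFeature d de) (Setoid.ker (Sum.elim i j))
      (messageMap P n (withLoops E) A i).1 = pairFeatures E X F j := by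
    rw [sum_keepWeight (fun i => (messageMap P n (withLoops E) A i).1) hj, hm j hj]
  rw [updateMap, sparseMap, if_pos hj]
  refine Prod.ext ?_ (Prod.ext ?_ ?_)
  · simp only [Prod.fst_sum, Prod.snd_sum]
    exact congrArg₂ P.U (by rw [← Prod.fst_sum]; exact congrArg Prod.fst hk) (hs 0)
  · simp only [Prod.fst_sum, Prod.snd_sum]
    exact congrArg₂ P.U (by rw [← Prod.fst_sum, ← Prod.snd_sum]; exact congrArg (·.2.1) hk) (hs 1)
  · simp only [Prod.fst_sum]
    exact congrArg (·.2.2) hk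

theorem MPNN.exists_stackApproximable {dH dK : ℕ} (hdH : 0 < dH)
    (φ : (Fin dH → ℝ) → Fin dK → ℝ) (hφ : ∃ x, φ x ≠ 0) {de T d d' : ℕ} (P : MPNN de T d d')
    (hP : P.IsContinuous) :
    ∃ g : ∀ n, Finset (MultiIndex 2 n) → (MultiIndex 2 n → PairFeature d de) → MultiIndex 2 n →
        PairFeature d' de,
      StackApproximable φ (2 * T) g ∧ (∀ n E, Continuous (g n E)) ∧
        ∀ (n : ℕ) (E : Finset (MultiIndex 2 n)), (∀ a, ![a, a] ∉ E) →
          ∀ (X : Fin n → Fin d → ℝ) (F : MultiIndex 2 n → Fin de → ℝ)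
            (A : MultiIndex 2 n → PairFeature d de),
            (∀ j ∈ withLoops E, A j = pairFeatures E X F j) →
              ∀ j ∈ withLoops E, g n (withLoops E) A j = pairFeatures E (P.eval E F X) F j := by
  induction P with
  | nil d => exact ⟨_, .zero φ, fun _ _ => continuous_id, fun _ _ _ _ _ _ hA => hA⟩
  | cons P N ih =>
    obtain ⟨g, hg, hgc, hgN⟩ := ih hP.2
    have hu := continuous_sparseMap (Y := PairFeature _ de × (Fin P.dm → ℝ))
      (fun μ => (keepWeight (PairFeature _ de) μ ∘L ContinuousLinearMap.fst ℝ _ _).prod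
        ((gatherWeight (Fin P.dm → ℝ) 0 μ ∘L ContinuousLinearMap.snd ℝ _ _).prod
          (gatherWeight (Fin P.dm → ℝ) 1 μ ∘L ContinuousLinearMap.snd ℝ _ _)))
      hP.1.continuous_update
    have hm := continuous_sparseMap (keepWeight (PairFeature _ de)) hP.1.continuous_message
    have h1 : StackApproximable φ (2 * _ + 1) fun n E A => g n E (updateMap P n E A) :=
      (layerApproximable_sparseMap hdH φ hφ _ hP.1.continuous_update).cons hg hu hgc
    have h2 := (layerApproximable_sparseMap hdH φ hφ (keepWeight (PairFeature _ de))
      hP.1.continuous_message).cons h1 hm fun n E => (hgc n E).comp (hu n E)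
    refine ⟨_, h2, fun n E => (hgc n E).comp ((hu n E).comp (hm n E)), ?_⟩
    intro n E hE X F A hA j hj
    exact hgN n E hE (P.eval E F X) F _ (fun i hi => updateMap_messageMap P hE X F hA hi) j hj

/-! ### Encoding and decoding of graphs; the approximating Transformer -/

theorem norm_encodeGraph_le {n dv de : ℕ} {R : ℝ} (E : Finset (MultiIndex 2 n))
    {X : Fin n → Fin dv → ℝ} {F : MultiIndex 2 n → Fin de → ℝ} (hX : ∀ a c, |X a c| ≤ R)
    (hF : ∀ i c, |F i c| ≤ R) : ‖encodeGraph E X F‖ ≤ |R| := by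
  have hR := le_abs_self R
  refine (pi_norm_le_iff_of_nonneg (abs_nonneg R)).2 fun i =>
    (pi_norm_le_iff_of_nonneg (abs_nonneg R)).2 fun c => ?_
  rw [Real.norm_eq_abs, encodeGraph]
  induction c using Fin.addCases with
  | left c =>
    rw [Fin.append_left]
    induction c using Fin.addCases with
    | left c => rw [Fin.append_left]; exact (hX _ _).trans hR
    | right c => rw [Fin.append_right]; exact (hX _ _).trans hR
  | right c =>
    rw [Fin.append_right]
    split_ifs
    · exact (hF _ _).trans hR
    · simp

/-- Reads the features of the endpoints and of the edge off the channels of `encodeGraph`. -/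
noncomputable def decodeGraph (dv de : ℕ) : (Fin (dv + dv + de) → ℝ) →L[ℝ] PairFeature dv de :=
  (ContinuousLinearMap.pi fun c => .proj (Fin.castAdd de (Fin.castAdd dv c))).prod
    ((ContinuousLinearMap.pi fun c => .proj (Fin.castAdd de (Fin.natAdd dv c))).prod
      (ContinuousLinearMap.pi fun c => .proj (Fin.natAdd (dv + dv) c)))

theorem decodeGraph_encodeGraph {n dv de : ℕ} (E : Finset (MultiIndex 2 n))
    (X : Fin n → Fin dv → ℝ) (F : MultiIndex 2 n → Fin de → ℝ) (i : MultiIndex 2 n) :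
    decodeGraph dv de (encodeGraph E X F i) = pairFeatures E X F i := by
  refine Prod.ext ?_ (Prod.ext ?_ ?_) <;> funext c <;>
    simp [decodeGraph, encodeGraph, pairFeatures, -Fin.natAdd_eq_addNat]

theorem exists_sparseTransformer_approx {dH dK : ℕ} (hdH : 0 < dH)
    (φ : (Fin dH → ℝ) → Fin dK → ℝ) (hφ : ∃ x, φ x ≠ 0) {dv de d T : ℕ} (P : MPNN de T dv d)
    (hP : P.IsContinuous) (n₀ : ℕ) (R : ℝ) {ε : ℝ} (hε : 0 < ε) :
    ∃ S : SparseTransformer dH (2 * T) (dv + dv + de) d,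
      ∀ n : ℕ, n ≤ n₀ → ∀ E : Finset (MultiIndex 2 n), (∀ a, ![a, a] ∉ E) →
        ∀ (X : Fin n → Fin dv → ℝ) (F : MultiIndex 2 n → Fin de → ℝ),
          (∀ a c, |X a c| ≤ R) → (∀ i c, |F i c| ≤ R) →
            ∀ j, ‖S.eval φ E X F j - P.eval E F X j‖ < ε := by
  obtain ⟨g, hg, -, hgP⟩ := P.exists_stackApproximable hdH φ hφ hP
  obtain ⟨w, S, D, hS⟩ := hg _ (decodeGraph dv de) n₀ |R| ε hε
  -- On the diagonal the first endpoint is the node itself; decoding it is linear, hence absorbed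
  -- into the output projection.
  let p : (Fin w → ℝ) →L[ℝ] (Fin d → ℝ) := ContinuousLinearMap.fst ℝ _ _ ∘L D
  refine ⟨⟨w, S, (LinearMap.toMatrix' (p : (Fin w → ℝ) →ₗ[ℝ] (Fin d → ℝ))).transpose⟩,
    fun n hn E hE X F hX hF j => ?_⟩
  have h1 := hS n hn (withLoops E) (encodeGraph E X F) (norm_encodeGraph_le E hX hF)
  have h2 := (norm_le_pi_norm _ ![j, j]).trans_lt h1
  rw [Pi.sub_apply, hgP n E hE X F _ (fun i _ => decodeGraph_encodeGraph E X F i) _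
    (pair_mem_withLoops E j)] at h2
  have h3 := (norm_fst_le _).trans_lt h2
  rw [SparseTransformer.eval, Matrix.vecMul_transpose, LinearMap.toMatrix'_mulVec]
  exact h3

/-! ### Message passing is confined to connected components -/

/-- In-neighbours of a node lie in its component, so one step preserves agreement of the features on
the whole component of `a`. -/
theorem MPNN.eval_eq_of_eqOn_component {de n T d d' : ℕ} (E : Finset (MultiIndex 2 n))
    (F : MultiIndex 2 n → Fin de → ℝ) (P : MPNN de T d d') {X X' : Fin n → Fin d → ℝ} {a : Fin n}
    (h : ∀ j, (SimpleGraph.fromRel fun a b : Fin n => ![a, b] ∈ E).Reachable a j → X j = X' j) :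
    P.eval E F X a = P.eval E F X' a := by
  induction P with
  | nil d => exact h a (SimpleGraph.Reachable.refl a)
  | cons P N ih =>
    refine ih fun j hj => ?_
    simp only [MPStep.eval, h j hj]
    congr 1
    refine Finset.sum_congr rfl fun i hi => ?_
    -- `SimpleGraph.fromRel` drops loops, so a possible loop in `E` is treated apart.
    rcases eq_or_ne j i with rfl | hne
    · rw [h j hj]
    · have hadj : (SimpleGraph.fromRel fun a b : Fin n => ![a, b] ∈ E).Adj j i :=
        (SimpleGraph.fromRel_adj _ _ _).2 ⟨hne, Or.inr (Finset.mem_filter.1 hi).2⟩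
      rw [h i (hj.trans hadj.reachable)]

/-! ### Attention across components -/

open Classical in
/-- Weights of the layer that sums a channel over all the other nodes. -/
noncomputable def otherNodesWeight {d : ℕ} (d' : ℕ) (c : Fin d) (μ : PairClass 2 2) :
    Matrix (Fin d) (Fin d') ℝ :=
  if μ (Sum.inl 0) (Sum.inl 1) ∧ μ (Sum.inr 0) (Sum.inr 1) ∧ ¬ μ (Sum.inl 0) (Sum.inr 0) then
    Matrix.of fun a _ => if a = c then 1 else 0
  else 0

/-- The selected class pairs the loop at `j` with the loops at all other nodes. Every loop lies in
`withLoops E`, so the sum ignores the edges. -/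
theorem sum_otherNodesWeight {n d d' : ℕ} (c : Fin d) (E : Finset (MultiIndex 2 n))
    (A : Tensor 2 n d) (j : Fin n) :
    ∑ i ∈ withLoops E,
        Matrix.vecMul (A i) (otherNodesWeight d' c (Setoid.ker (Sum.elim i ![j, j])))
      = fun _ => ∑ k ∈ Finset.univ.erase j, A ![k, k] c := by
  classical
  have hv : ∀ i : MultiIndex 2 n,
      Matrix.vecMul (A i) (otherNodesWeight d' c (Setoid.ker (Sum.elim i ![j, j])))
        = if i 0 = i 1 ∧ i 0 ≠ j then (fun _ => A i c : Fin d' → ℝ) else 0 := by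
    intro i
    by_cases h : i 0 = i 1 ∧ i 0 ≠ j
    · have hw : otherNodesWeight d' c (Setoid.ker (Sum.elim i ![j, j]))
          = Matrix.of fun a _ => if a = c then 1 else 0 :=
        if_pos ⟨h.1, rfl, h.2⟩
      rw [hw, if_pos h]
      funext r
      simp [Matrix.vecMul, dotProduct]
    · have hw : otherNodesWeight d' c (Setoid.ker (Sum.elim i ![j, j])) = 0 :=
        if_neg fun h' => h ⟨h'.1, h'.2.2⟩
      rw [hw, if_neg h, Matrix.vecMul_zero]
  simp only [hv]
  rw [← Finset.sum_filter]
  funext r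
  rw [Finset.sum_apply]
  refine Finset.sum_nbij' (fun i => i 0) (fun k => ![k, k]) ?_ ?_ ?_ ?_ ?_
  · intro i hi
    simpa using (Finset.mem_filter.1 hi).2.2
  · intro k hk
    simpa [pair_mem_withLoops] using hk
  · intro i hi
    have h01 := (Finset.mem_filter.1 hi).2.1
    funext b
    fin_cases b
    · rfl
    · exact h01
  · intro k _
    rfl
  · intro i hi
    have h01 := (Finset.mem_filter.1 hi).2.1
    have : ![i 0, i 0] = i := by
      funext b
      fin_cases b
      · rfl
      · exact h01
    rw [this]

theorem exists_sparseTransformer_sum_otherNodes {dH dK : ℕ} (hdH : 0 < dH)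
    (φ : (Fin dH → ℝ) → Fin dK → ℝ) (hφ : ∃ x, φ x ≠ 0) {dv : ℕ} (de d : ℕ) (c : Fin dv) :
    ∃ S : SparseTransformer dH 1 (dv + dv + de) d,
      ∀ (n : ℕ) (E : Finset (MultiIndex 2 n)) (X : Fin n → Fin dv → ℝ)
        (F : MultiIndex 2 n → Fin de → ℝ) (j : Fin n),
        S.eval φ E X F j = fun _ => ∑ k ∈ Finset.univ.erase j, X k c := by
  obtain ⟨x, hx⟩ := hφ
  have hr : φ x ⬝ᵥ φ x * (φ x ⬝ᵥ φ x)⁻¹ = 1 :=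
    mul_inv_cancel₀ fun h => hx (dotProduct_self_eq_zero.1 h)
  -- An MLP of hidden width `0` contributes nothing, so the layer is its attention.
  refine ⟨⟨d, .cons (.ofLinear x (φ x ⬝ᵥ φ x)⁻¹
    (otherNodesWeight d (Fin.castAdd de (Fin.castAdd dv c)))
    (.entrywise 2 (0 : Matrix _ (Fin 0) ℝ) 0) (.entrywise 2 0 0)) (.nil d), 1⟩,
    fun n E X F j => ?_⟩
  rw [SparseTransformer.eval]
  simp only [EncStack.eval, Matrix.vecMul_one]
  rw [EncLayer.ofLinear_eval hdH φ hr _ _ _ _ _ _ (pair_mem_withLoops E j), sum_otherNodesWeight]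
  funext r
  simp [encodeGraph]

theorem sum_erase_single {n dv : ℕ} {a b : Fin n} (hab : a ≠ b) (v : Fin dv → ℝ) (c : Fin dv) :
    ∑ k ∈ Finset.univ.erase a, (Pi.single b v : Fin n → Fin dv → ℝ) k c = v c := by
  rw [Finset.sum_eq_single_of_mem b (by simpa using hab.symm)]
  · simp
  · intro k _ hk
    simp [hk]

theorem exists_sparseTransformer_far_from_mpnn {dH dK : ℕ} (hdH : 0 < dH)
    (φ : (Fin dH → ℝ) → Fin dK → ℝ) (hφ : ∃ x, φ x ≠ 0) (dv de d : ℕ) (hdv : 0 < dv)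
    (hd : 0 < d) :
    ∃ (S : SparseTransformer dH 1 (dv + dv + de) d) (ε : ℝ), 0 < ε ∧
      ∀ (n : ℕ) (E : Finset (MultiIndex 2 n)),
        ¬ (SimpleGraph.fromRel fun a b : Fin n => ![a, b] ∈ E).Preconnected →
          ∀ (T : ℕ) (P : MPNN de T dv d),
            ∃ (X : Fin n → Fin dv → ℝ) (F : MultiIndex 2 n → Fin de → ℝ),
              (∀ a c, |X a c| ≤ 1) ∧ (∀ i c, |F i c| ≤ 1) ∧
                ∃ j, ε ≤ ‖S.eval φ E X F j - P.eval E F X j‖ := by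
  obtain ⟨S, hS⟩ := exists_sparseTransformer_sum_otherNodes hdH φ hφ de d (⟨0, hdv⟩ : Fin dv)
  refine ⟨S, 1, one_pos, fun n E hE T P => ?_⟩
  obtain ⟨a, b, hab⟩ : ∃ a b,
      ¬ (SimpleGraph.fromRel fun a b : Fin n => ![a, b] ∈ E).Reachable a b := by
    simpa [SimpleGraph.Preconnected] using hE
  have hne : a ≠ b := by
    rintro rfl
    exact hab (SimpleGraph.Reachable.refl a)
  -- Only `b`, unreachable from `a`, carries a nonzero feature: at `a` the Transformer returns `s`,
  -- while the network cannot tell `1` from `-1`.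
  let X : ℝ → Fin n → Fin dv → ℝ := fun s => Pi.single b fun _ => s
  have hX : ∀ s, |s| ≤ 1 → ∀ k c, |X s k c| ≤ 1 := by
    intro s hs k c
    by_cases hk : k = b
    · subst hk
      simpa [X] using hs
    · simp [X, hk]
  have hloc : P.eval E 0 (X 1) a = P.eval E 0 (X (-1)) a := by
    refine P.eval_eq_of_eqOn_component E 0 fun j hj => ?_
    have hjb : j ≠ b := by
      rintro rfl
      exact hab hj
    simp [X, hjb]
  by_contra! hcon
  have h1 := hcon (X 1) 0 (hX 1 (by simp)) (by simp) a
  have h2 := hcon (X (-1)) 0 (hX (-1) (by simp)) (by simp) a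
  have hval : ∀ s, S.eval φ E (X s) 0 a = fun _ => s := fun s => by
    rw [hS]
    funext r
    exact sum_erase_single hne _ _
  rw [hval] at h1 h2
  rw [hloc] at h1
  have h3 := (norm_le_pi_norm _ (⟨0, hd⟩ : Fin d)).trans_lt h1
  have h4 := (norm_le_pi_norm _ (⟨0, hd⟩ : Fin d)).trans_lt h2
  rw [Pi.sub_apply, Real.norm_eq_abs, abs_lt] at h3 h4
  linarith [h3.2, h4.1]

theorem mainTheorem2 {dH dK : ℕ} (hdH : 0 < dH) (φ : (Fin dH → ℝ) → Fin dK → ℝ)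
    (hφ_nonneg : ∀ x c, 0 ≤ φ x c) (hφ_ne : ∃ x, φ x ≠ 0) :
    (∀ (dv de d T : ℕ) (P : MPNN de T dv d), P.IsContinuous →
      ∀ (n₀ : ℕ) (R ε : ℝ), 0 < ε →
        ∃ S : SparseTransformer dH (2 * T) (dv + dv + de) d,
          ∀ n : ℕ, n ≤ n₀ → ∀ E : Finset (MultiIndex 2 n), (∀ a, ![a, a] ∉ E) →
            ∀ (X : Fin n → Fin dv → ℝ) (F : MultiIndex 2 n → Fin de → ℝ),
              (∀ a c, |X a c| ≤ R) → (∀ i c, |F i c| ≤ R) →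
                ∀ j, ‖S.eval φ E X F j - P.eval E F X j‖ < ε) ∧
    (∀ dv de d : ℕ, 0 < dv → 0 < d →
      ∃ (S : SparseTransformer dH 1 (dv + dv + de) d) (ε : ℝ), 0 < ε ∧
        ∀ (n : ℕ) (E : Finset (MultiIndex 2 n)), (∀ a, ![a, a] ∉ E) →
          ¬ (SimpleGraph.fromRel fun a b : Fin n => ![a, b] ∈ E).Preconnected →
            ∀ (T : ℕ) (P : MPNN de T dv d),
              ∃ (X : Fin n → Fin dv → ℝ) (F : MultiIndex 2 n → Fin de → ℝ),
                (∀ a c, |X a c| ≤ 1) ∧ (∀ i c, |F i c| ≤ 1) ∧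
                  ∃ j, ε ≤ ‖S.eval φ E X F j - P.eval E F X j‖) :=
  ⟨fun _ _ _ _ P hP n₀ R _ hε => exists_sparseTransformer_approx hdH φ hφ_ne P hP n₀ R hε,
    fun dv de d hdv hd => by
      obtain ⟨S, ε, hε, h⟩ := exists_sparseTransformer_far_from_mpnn hdH φ hφ_ne dv de d hdv hd
      exact ⟨S, ε, hε, fun n E _ => h n E⟩⟩
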